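/- Let $k,m\in\mathbb N$ and let $M_n$ denote the complex $n\times n$ matrices, $M_n^+$ the cone of positive semidefinite ones, and identify $M_n\otimes M_m$ with $M_n(M_m)$, the $n\times n$ matrices over $M_m$. The following matrix orderings on $M_m$ are considered, given by cones in $M_n(M_m)$, $n\ge 1$: \begin{itemize} \item the usual operator system $M_m=B(\mathbb C^m)$: $M_n(M_m)^+$ consists of the matrices that are positive semidefinite in $M_n(M_m)\cong M_{nm}$; \item $\operatorname{OMIN}(M_m)$: $C_n^{\min}$ consists of the $(v_{ij})\in M_n(M_m)$ with $\sum_{i,j}\overline{\lambda_i}\lambda_j v_{ij}\in M_m^+$ for all $\lambda_1,\dots,\lambda_n\in\mathbb C$; \item $\operatorname{OMAX}(M_m)$: $C_n^{\max}$ consists of the $A\in M_n(M_m)$ such that for every $r>0$ the matrix $rI+A$ is a finite sum of tensors $a\otimes v$ with $a\in M_n^+$, $v\in M_m^+$. \end{itemize} For a linear map $\phi:M_k\to M_m$ let $\phi_n:M_n(M_k)\to M_n(M_m)$ be its entrywise application. $\phi$ is completely positive with respect to given matrix orderings if for every $n$ the map $\phi_n$ maps the $n$-th cone of the domain into the $n$-th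 cone of the range. A positive linear functional on $M_n\otimes M_k$ (nonnegative on $M_n(M_k)^+$) is called separable if it is a finite sum of functionals $f\otimes g$ with $f$, $g$ positive linear functionals on $M_n$, $M_k$. $\phi$ is called entanglement breaking if for every $n$ and every state $s$ on $M_n\otimes M_m$ (a positive linear functional with $s(I)=1$) the functional $s\circ\phi_n$ is a separable positive linear functional on $M_n\otimes M_k$. Let $\gamma_n:M_n\to M_n'$ be the linear isomorphism onto the dual space that maps the matrix units $E_{ij}$ to the dual basis, let $\phi'$ be the dual map of $\phi$, and put $\phi^\flat=\gamma_k^{-1}\circ\phi'\circ\gamma_m:M_m\to M_k$. $\phi$ is called co-entanglement breaking if $\phi^\flat$ is entanglement breaking. Then for every linear map $\phi:M_k\to M_m$ the following are equivalent: \begin{itemize} \item[(i)] $\phi:\operatorname{OMIN}(M_k)\to M_m$ is completely positive; \item[(ii)] $\phi$ is entanglement breaking; \item[(iii)] $\phi$ is co-entanglement breaking; \item[(iv)] $\phi:M_k\to\operatorname{OMAX}(M_m)$ is completely positive; \item[(v)] there are $K\ge 0$, positive linear functionals $s_l:M_k\to\mathbb C$ and matrices $P_l\in M_m^+$, $1\le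 l\le K$, with $\phi(X)=\sum_{l=1}^K s_l(X)P_l$ for all $X\in M_k$; \item[(vi)] there are $N\ge 0$ and $k\times m$ matrices $A_l$ of rank one, $1\le l\le N$, with $\phi(X)=\sum_{l=1}^N A_l^*XA_l$ for all $X\in M_k$; \item[(vii)] $\phi:\operatorname{OMIN}(M_k)\to\operatorname{OMAX}(M_m)$ is completely positive. \end{itemize} Empty sums ($K=0$, $N=0$) are zero. -/

import Mathlib

open scoped ComplexOrder

noncomputable section

namespace OpSys

/-- The algebra `M_n` of complex `n × n` matrices. -/
abbrev Mat (n : ℕ) : Type := Matrix (Fin n) (Fin n) ℂ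

/-- The cone `M_n^+` of positive (semidefinite) matrices. -/
def posCone (n : ℕ) : Set (Mat n) := {X | X.PosSemidef}

section General

variable {V W : Type*} [AddCommGroup V] [Module ℂ V] [AddCommGroup W] [Module ℂ W]

/-- A family of subsets `C_n ⊆ M_n(V)`, one for each matrix size. -/
abbrev MatrixCones (V : Type*) : Type _ := ∀ n : ℕ, Set (Matrix (Fin n) (Fin n) V)

/-- The elementary tensor `a ⊗ v`, as the element `(a_{ij} v)_{ij}` of `M_n(V) = M_n ⊗ V`. -/
def elemTensor {n : ℕ} (a : Mat n) (v : V) : Matrix (Fin n) (Fin n) V :=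
  Matrix.of fun i j => a i j • v

/-- `φ : V → W` is completely positive for the matrix cones `C` on `V` and `D` on `W`:
`φ_n(C_n) ⊆ D_n` for all `n`, where `φ_n` applies `φ` entrywise. -/
def IsCompletelyPositive (C : MatrixCones V) (D : MatrixCones W) (φ : V →ₗ[ℂ] W) : Prop :=
  ∀ n : ℕ, ∀ A ∈ C n, (φ.mapMatrix : Matrix (Fin n) (Fin n) V →ₗ[ℂ] _) A ∈ D n

/-- `C_n^min(V)`: the matrices `(v_{ij})` with `∑ conj(c_i) c_j v_{ij} ∈ V⁺` for all scalars `c`. -/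
def cMin (P : Set V) : MatrixCones V := fun n =>
  {A | ∀ c : Fin n → ℂ, ∑ i, ∑ j, (star (c i) * c j) • A i j ∈ P}

/-- `D_n^max(V)`: the finite sums of `a ⊗ v` with `a ∈ M_n^+` and `v ∈ V⁺`. -/
def dMax (P : Set V) : MatrixCones V := fun n =>
  {A | ∃ (q : ℕ) (a : Fin q → Mat n) (v : Fin q → V),
    (∀ l, a l ∈ posCone n) ∧ (∀ l, v l ∈ P) ∧ A = ∑ l, elemTensor (a l) (v l)}

/-- `C_n^max(V)`: the Archimedeanization of `D_n^max(V)` with respect to the unit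
`e_n = diag(e, …, e)`. -/
def cMax (P : Set V) (e : V) : MatrixCones V := fun n =>
  {A | ∀ r : ℝ, 0 < r → (r : ℂ) • Matrix.diagonal (fun _ : Fin n => e) + A ∈ dMax P n}

/-- A linear functional is positive if it is nonnegative (in particular real) on the cone `P`. -/
def IsPositiveFunctional (P : Set V) (f : V →ₗ[ℂ] ℂ) : Prop := ∀ v ∈ P, 0 ≤ f v

/-- A state is a positive functional with value `1` at the unit `e`. -/
def IsState (P : Set V) (e : V) (f : V →ₗ[ℂ] ℂ) : Prop :=
  IsPositiveFunctional P f ∧ f e = 1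

/-- The functional `s ⊗ t` on `M_n(V) = M_n ⊗ V`: it sends `(v_{ij})` to `s((t(v_{ij})))`. -/
def tensorFunctional {n : ℕ} (s : Mat n →ₗ[ℂ] ℂ) (t : V →ₗ[ℂ] ℂ) :
    Matrix (Fin n) (Fin n) V →ₗ[ℂ] ℂ :=
  s ∘ₗ t.mapMatrix

theorem tensorFunctional_elemTensor {n : ℕ} (s : Mat n →ₗ[ℂ] ℂ) (t : V →ₗ[ℂ] ℂ)
    (a : Mat n) (v : V) : tensorFunctional s t (elemTensor a v) = s a * t v := by
  have h : t.mapMatrix (elemTensor a v) = t v • a := by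
    ext i j
    simp [elemTensor, mul_comm]
  simp [tensorFunctional, h, mul_comm]

end General

/-- The matrix cones of the usual operator system `M_m = B(ℂ^m)`: an `n × n` matrix over `M_m` is
positive if it is so as an `nm × nm` complex matrix. -/
def stdCone (m : ℕ) : MatrixCones (Mat m) := fun n =>
  {A | (Matrix.comp (Fin n) (Fin n) (Fin m) (Fin m) ℂ A).PosSemidef}

/-- The matrix cones of `OMIN(M_m)`. -/
def ominCone (m : ℕ) : MatrixCones (Mat m) := cMin (posCone m)

/-- The matrix cones of `OMAX(M_m)`. -/
def omaxCone (m : ℕ) : MatrixCones (Mat m) := cMax (posCone m) 1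

/-- A positive linear functional on `M_n ⊗ M_m = M_n(M_m)` is separable if it is a finite sum of
tensors of positive linear functionals. -/
def IsSeparable {n m : ℕ} (f : Matrix (Fin n) (Fin n) (Mat m) →ₗ[ℂ] ℂ) : Prop :=
  IsPositiveFunctional (stdCone m n) f ∧
    ∃ (q : ℕ) (s : Fin q → Mat n →ₗ[ℂ] ℂ) (t : Fin q → Mat m →ₗ[ℂ] ℂ),
      (∀ l, IsPositiveFunctional (posCone n) (s l)) ∧
      (∀ l, IsPositiveFunctional (posCone m) (t l)) ∧
      f = ∑ l, tensorFunctional (s l) (t l)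

/-- `φ : M_k → M_m` is entanglement breaking if `s ∘ φ_n` is a separable positive linear functional
for every `n` and every state `s` of `M_n ⊗ M_m`. -/
def IsEntanglementBreaking {k m : ℕ} (φ : Mat k →ₗ[ℂ] Mat m) : Prop :=
  ∀ (n : ℕ) (s : Matrix (Fin n) (Fin n) (Mat m) →ₗ[ℂ] ℂ),
    IsState (stdCone m n) 1 s → IsSeparable (s ∘ₗ φ.mapMatrix)

/-- The linear isomorphism `γ_n : M_n → M_n'` that maps the matrix units `E_{ij}` to the dual
basis `δ_{ij}`. -/
def gamma (n : ℕ) : Mat n ≃ₗ[ℂ] Module.Dual ℂ (Mat n) :=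
  (Matrix.stdBasis ℂ (Fin n) (Fin n)).toDualEquiv

/-- `φ^♭ = γ_k⁻¹ ∘ φ' ∘ γ_m : M_m → M_k`, with `φ'` the transpose of `φ`. -/
def flat {k m : ℕ} (φ : Mat k →ₗ[ℂ] Mat m) : Mat m →ₗ[ℂ] Mat k :=
  (gamma k).symm.toLinearMap ∘ₗ φ.dualMap ∘ₗ (gamma m).toLinearMap

/-- `φ` is co-entanglement breaking if `φ^♭` is entanglement breaking. -/
def IsCoEntanglementBreaking {k m : ℕ} (φ : Mat k →ₗ[ℂ] Mat m) : Prop :=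
  IsEntanglementBreaking (flat φ)

end OpSys

end

/-! Everything passes through (v), `IsMeasureAndPrepare`. Writing `φ(X) = ∑ X_ij φ(E_ij)` shows that
(v) follows once the Choi matrix of `φ` is a finite sum of positive tensors, i.e. lies in `dMax`.
The cone `dMax` is closed, being a cone over a compact convex set in the hyperplane of trace one.
Hence Archimedeanization adds nothing (`omaxCone_eq_dMax`), and (iv), applied to the positive matrix
`(E_ij)`, gives (v). Closedness also permits Hahn-Banach: if the Choi matrix is outside `dMax`, a
separating functional yields a block-positive `witness` in OMIN whose image under `φ` fails to be
positive, contradicting (i). Entanglement breaking gives (i) because separable functionals are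
nonnegative on the larger OMIN cones. The form (v) is stable under the involution `flat`, which
settles (iii), and spectral decomposition of its ingredients gives (vi). -/

open scoped ComplexOrder

/-! ### Carathéodory's theorem and closed cones over compact bases. -/

section ConvexCones

variable {E : Type*} [NormedAddCommGroup E] [NormedSpace ℝ E]

/-- In finite dimension the convex hull of a compact set is compact. -/
theorem IsCompact.isCompact_convexHull [FiniteDimensional ℝ E] {S : Set E} (hS : IsCompact S) :
    IsCompact (convexHull ℝ S) := by
  rcases S.eq_empty_or_nonempty with rfl | ⟨x₀, hx₀⟩
  · simp
  set d := Module.finrank ℝ E + 1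
  have hK : IsCompact (stdSimplex ℝ (Fin d) ×ˢ Set.univ.pi fun _ : Fin d => S) :=
    (isCompact_stdSimplex ℝ (Fin d)).prod (isCompact_univ_pi fun _ => hS)
  have hf : Continuous fun p : (Fin d → ℝ) × (Fin d → E) => ∑ i, p.1 i • p.2 i := by fun_prop
  convert hK.image hf using 1
  apply Set.Subset.antisymm
  · intro x hx
    obtain ⟨ι, _, z, w, hz, hind, hw, hw1, rfl⟩ := eq_pos_convex_span_of_mem_convexHull hx
    have hcard : Fintype.card ι ≤ Fintype.card (Fin d) := by
      rw [Fintype.card_fin]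
      exact hind.card_le_finrank_succ.trans
        (Nat.succ_le_succ (Submodule.finrank_le _))
    obtain ⟨e⟩ := Function.Embedding.nonempty_of_card_le hcard
    have hext : ∀ i, (¬∃ j, e j = i) → Function.extend e w 0 i = 0 := fun i hi => by
      rw [Function.extend_apply' _ _ _ hi, Pi.zero_apply]
    have hsum : ∑ i, Function.extend e w 0 i = 1 := by
      rw [← hw1]
      refine (Fintype.sum_of_injective e e.injective _ _ (fun i hi => ?_) fun i => ?_).symm
      · exact hext i hi
      · rw [e.injective.extend_apply]
    -- Carathéodory may use fewer than `d` points; the list is padded by `x₀` with weight zero.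
    refine ⟨(Function.extend e w 0, Function.extend e z fun _ => x₀), ⟨⟨fun i => ?_, hsum⟩, ?_⟩, ?_⟩
    · by_cases hi : ∃ j, e j = i
      · obtain ⟨j, rfl⟩ := hi
        simpa [e.injective.extend_apply] using (hw j).le
      · simp [hext i hi]
    · intro i _
      by_cases hi : ∃ j, e j = i
      · obtain ⟨j, rfl⟩ := hi
        simpa [e.injective.extend_apply] using hz ⟨j, rfl⟩
      · simpa [Function.extend_apply' z _ i hi] using hx₀
    · refine (Fintype.sum_of_injective e e.injective _ _ (fun i hi => ?_) fun i => ?_).symm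
      · simp [hext i hi]
      · simp [e.injective.extend_apply]
  · rintro _ ⟨⟨w, z⟩, ⟨⟨hw0, hw1⟩, hz⟩, rfl⟩
    exact (convex_convexHull ℝ S).sum_mem (fun i _ => hw0 i) hw1
      fun i _ => subset_convexHull ℝ S (hz i trivial)

/-- The pointed cone `ℝ≥0 • K ∪ {0}` over a set `K`. -/
def coneOver (K : Set E) : Set E := insert 0 {x | ∃ t : ℝ, 0 ≤ t ∧ ∃ y ∈ K, x = t • y}

theorem smul_mem_coneOver {K : Set E} {t : ℝ} (ht : 0 ≤ t) {y : E} (hy : y ∈ K) :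
    t • y ∈ coneOver K := Or.inr ⟨t, ht, y, hy, rfl⟩

theorem add_mem_coneOver {K : Set E} (hK : Convex ℝ K) {x y : E} (hx : x ∈ coneOver K)
    (hy : y ∈ coneOver K) : x + y ∈ coneOver K := by
  rcases hx with rfl | ⟨t, ht, a, ha, rfl⟩
  · simpa using hy
  rcases hy with rfl | ⟨u, hu, b, hb, rfl⟩
  · simpa using smul_mem_coneOver ht ha
  rcases (add_nonneg ht hu).eq_or_lt with h | h
  · have h1 : t = 0 := by linarith
    have h2 : u = 0 := by linarith
    simp [h1, h2, coneOver]
  · refine Or.inr ⟨t + u, h.le, (t / (t + u)) • a + (u / (t + u)) • b,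
      hK ha hb (by positivity) (by positivity) (by field_simp), ?_⟩
    rw [smul_add, smul_smul, smul_smul, mul_div_cancel₀ _ h.ne', mul_div_cancel₀ _ h.ne']

theorem sum_mem_coneOver {K : Set E} (hK : Convex ℝ K) {ι : Type*} (s : Finset ι) {f : ι → E}
    (hf : ∀ i ∈ s, f i ∈ coneOver K) : ∑ i ∈ s, f i ∈ coneOver K :=
  Finset.sum_induction f (· ∈ coneOver K) (fun _ _ => add_mem_coneOver hK) (Or.inl rfl) hf

/-- The cone over a compact set contained in an affine hyperplane off the origin is closed. -/
theorem isClosed_coneOver {K : Set E} (hK : IsCompact K) (τ : E →L[ℝ] ℝ)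
    (hτ : ∀ x ∈ K, τ x = 1) : IsClosed (coneOver K) := by
  refine (isClosed_singleton (x := (0 : E))).union (isClosed_of_closure_subset fun x hx => ?_)
  -- On the cone `τ (t • z) = t`, so points near `x` have bounded `t` and lie in this compact image.
  have hT : IsCompact ((fun p : ℝ × E => p.1 • p.2) '' (Set.Icc 0 (τ x + 1) ×ˢ K)) :=
    (isCompact_Icc.prod hK).image (by fun_prop)
  have hU : IsOpen {y | τ y < τ x + 1} := isOpen_lt τ.continuous continuous_const
  have hx' := hU.inter_closure ⟨(by simp : τ x < τ x + 1), hx⟩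
  have hsub : {y | τ y < τ x + 1} ∩ {y | ∃ t : ℝ, 0 ≤ t ∧ ∃ z ∈ K, y = t • z} ⊆
      (fun p : ℝ × E => p.1 • p.2) '' (Set.Icc 0 (τ x + 1) ×ˢ K) := by
    rintro _ ⟨hy, t, ht, z, hz, rfl⟩
    refine ⟨(t, z), ⟨⟨ht, ?_⟩, hz⟩, rfl⟩
    have : τ (t • z) < τ x + 1 := hy
    simp only [map_smul, hτ z hz, smul_eq_mul, mul_one] at this
    exact this.le
  obtain ⟨⟨t, z⟩, ⟨⟨ht, _⟩, hz⟩, rfl⟩ := hT.isClosed.closure_subset_iff.2 hsub hx'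
  exact ⟨t, ht, z, hz, rfl⟩

end ConvexCones

/-! ### The matrix cones and their elementary inclusions. -/

namespace OpSys

/-- Over `ℂ` a quadratic form with real values already forces the matrix to be Hermitian. -/
theorem posSemidef_iff_forall_sum_nonneg {ι : Type*} [Fintype ι] {M : Matrix ι ι ℂ} :
    M.PosSemidef ↔ ∀ x : ι → ℂ, 0 ≤ ∑ i, ∑ j, star (x i) * x j * M i j := by
  classical
  have key : ∀ x : ι → ℂ,
      star x ⬝ᵥ (M.mulVec x) = ∑ i, ∑ j, star (x i) * x j * M i j := fun x => by
    simp only [dotProduct, Matrix.mulVec, Finset.mul_sum, Pi.star_apply]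
    exact Finset.sum_congr rfl fun i _ => Finset.sum_congr rfl fun j _ => by ring
  refine ⟨fun h x => key x ▸ h.dotProduct_mulVec_nonneg x, fun h => ?_⟩
  rw [← Matrix.isPositive_toEuclideanLin_iff, LinearMap.isPositive_iff_complex]
  intro x
  have hx := key x.ofLp ▸ h x.ofLp
  have hin : inner ℂ (M.toEuclideanLin x) x = star (star x.ofLp ⬝ᵥ (M.mulVec x.ofLp)) := by
    rw [← inner_conj_symm]
    simp [PiLp.inner_apply, dotProduct, Matrix.toEuclideanLin, mul_comm]
  rw [hin, (IsSelfAdjoint.of_nonneg hx).star_eq]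
  rw [Complex.nonneg_iff] at hx
  exact ⟨Complex.ext (by simp) (by simp [← hx.2]), by simpa using hx.1⟩

theorem elemTensor_apply {n m : ℕ} (a : Mat n) (v : Mat m) (i j : Fin n) (p q : Fin m) :
    elemTensor a v i j p q = a i j * v p q := rfl

theorem mem_stdCone_iff {n m : ℕ} {A : Matrix (Fin n) (Fin n) (Mat m)} :
    A ∈ stdCone m n ↔ ∀ x : Fin n → Fin m → ℂ,
      0 ≤ ∑ i, ∑ p, ∑ j, ∑ q, star (x i p) * x j q * A i j p q := by
  refine Iff.trans posSemidef_iff_forall_sum_nonneg ⟨fun h x => ?_, fun h x => ?_⟩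
  · simpa [Fintype.sum_prod_type] using h fun ip => x ip.1 ip.2
  · simpa [Fintype.sum_prod_type] using h fun i p => x (i, p)

theorem mem_ominCone_iff {n m : ℕ} {A : Matrix (Fin n) (Fin n) (Mat m)} :
    A ∈ ominCone m n ↔ ∀ (c : Fin n → ℂ) (x : Fin m → ℂ),
      0 ≤ ∑ p, ∑ q, star (x p) * x q * ∑ i, ∑ j, star (c i) * c j * A i j p q := by
  simp only [ominCone, cMin, posCone, Set.mem_ofPred_eq, posSemidef_iff_forall_sum_nonneg,
    Matrix.sum_apply, Matrix.smul_apply, smul_eq_mul]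

/-- OMIN tests the form only on product vectors `c ⊗ x`. -/
theorem stdCone_subset_ominCone (n m : ℕ) : stdCone m n ⊆ ominCone m n := by
  intro A hA
  rw [mem_ominCone_iff]
  intro c x
  convert mem_stdCone_iff.1 hA (fun i p => c i * x p) using 1
  simp only [Finset.mul_sum, star_mul']
  refine (Finset.sum_congr rfl fun p _ => Finset.sum_comm).trans ?_
  rw [Finset.sum_comm]
  refine Finset.sum_congr rfl fun i _ => Finset.sum_congr rfl fun p _ => ?_
  rw [Finset.sum_comm]
  refine Finset.sum_congr rfl fun j _ => Finset.sum_congr rfl fun q _ => ?_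
  ring

/-- A positive functional maps `C_n^min` entrywise into `M_n^+`. -/
theorem mapMatrix_mem_posCone {V : Type*} [AddCommGroup V] [Module ℂ V] {P : Set V} {n : ℕ}
    {t : V →ₗ[ℂ] ℂ} (ht : IsPositiveFunctional P t) {A : Matrix (Fin n) (Fin n) V}
    (hA : A ∈ cMin P n) : t.mapMatrix A ∈ posCone n := by
  refine posSemidef_iff_forall_sum_nonneg.2 fun c => ?_
  simpa [map_sum] using ht _ (hA c)

theorem elemTensor_mem_stdCone {n m : ℕ} {a : Mat n} {v : Mat m} (ha : a ∈ posCone n)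
    (hv : v ∈ posCone m) : elemTensor a v ∈ stdCone m n :=
  Matrix.PosSemidef.kronecker ha hv

theorem add_mem_stdCone {n m : ℕ} {A B : Matrix (Fin n) (Fin n) (Mat m)} (hA : A ∈ stdCone m n)
    (hB : B ∈ stdCone m n) : A + B ∈ stdCone m n :=
  Matrix.PosSemidef.add hA hB

theorem zero_mem_stdCone (n m : ℕ) : (0 : Matrix (Fin n) (Fin n) (Mat m)) ∈ stdCone m n :=
  Matrix.PosSemidef.zero

theorem dMax_subset_stdCone (n m : ℕ) : dMax (posCone m) n ⊆ stdCone m n := by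
  rintro _ ⟨q, a, v, ha, hv, rfl⟩
  exact Finset.sum_induction _ (· ∈ stdCone m n) (fun _ _ => add_mem_stdCone)
    (zero_mem_stdCone n m) fun l _ => elemTensor_mem_stdCone (ha l) (hv l)

theorem mem_dMax_of_fintype {V : Type*} [AddCommGroup V] [Module ℂ V] {P : Set V} {n : ℕ}
    {ι : Type*} [Fintype ι] {a : ι → Mat n} {v : ι → V} (ha : ∀ l, a l ∈ posCone n)
    (hv : ∀ l, v l ∈ P) : ∑ l, elemTensor (a l) (v l) ∈ dMax P n :=
  ⟨Fintype.card ι, a ∘ (Fintype.equivFin ι).symm, v ∘ (Fintype.equivFin ι).symm,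
    fun _ => ha _, fun _ => hv _, ((Fintype.equivFin ι).symm.sum_comp _).symm⟩

theorem add_mem_dMax {V : Type*} [AddCommGroup V] [Module ℂ V] {P : Set V} {n : ℕ}
    {A B : Matrix (Fin n) (Fin n) V} (hA : A ∈ dMax P n) (hB : B ∈ dMax P n) :
    A + B ∈ dMax P n := by
  obtain ⟨q, a, v, ha, hv, rfl⟩ := hA
  obtain ⟨r, b, w, hb, hw, rfl⟩ := hB
  have := mem_dMax_of_fintype (P := P) (a := Sum.elim a b) (v := Sum.elim v w)
    (Sum.forall.2 ⟨ha, hb⟩) (Sum.forall.2 ⟨hv, hw⟩)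
  simpa [Fintype.sum_sum_type] using this

theorem elemTensor_mem_dMax {V : Type*} [AddCommGroup V] [Module ℂ V] {P : Set V} {n : ℕ}
    {a : Mat n} {v : V} (ha : a ∈ posCone n) (hv : v ∈ P) : elemTensor a v ∈ dMax P n :=
  ⟨1, fun _ => a, fun _ => v, fun _ => ha, fun _ => hv, by simp⟩

theorem zero_mem_dMax {V : Type*} [AddCommGroup V] [Module ℂ V] (P : Set V) (n : ℕ) :
    (0 : Matrix (Fin n) (Fin n) V) ∈ dMax P n :=
  ⟨0, Fin.elim0, Fin.elim0, fun l => l.elim0, fun l => l.elim0, by simp⟩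

theorem smul_mem_dMax {V : Type*} [AddCommGroup V] [Module ℂ V] {P : Set V} {n : ℕ}
    {A : Matrix (Fin n) (Fin n) V} (hA : A ∈ dMax P n) {r : ℝ} (hr : 0 ≤ r) :
    (r : ℂ) • A ∈ dMax P n := by
  obtain ⟨q, a, v, ha, hv, rfl⟩ := hA
  refine ⟨q, fun l => (r : ℂ) • a l, v, fun l => ?_, hv, ?_⟩
  · exact Matrix.PosSemidef.smul (ha l) (Complex.zero_le_real.2 hr)
  · rw [Finset.smul_sum]
    refine Finset.sum_congr rfl fun l _ => ?_
    ext i j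
    simp [elemTensor, smul_smul]

theorem diagonal_eq_elemTensor {V : Type*} [AddCommGroup V] [Module ℂ V] (n : ℕ) (e : V) :
    Matrix.diagonal (fun _ : Fin n => e) = elemTensor 1 e := by
  ext i j
  by_cases h : i = j <;> simp [elemTensor, Matrix.one_apply, h]

theorem one_mem_posCone (n : ℕ) : (1 : Mat n) ∈ posCone n := Matrix.PosSemidef.one

theorem dMax_subset_omaxCone (n m : ℕ) : dMax (posCone m) n ⊆ omaxCone m n := by
  intro A hA r hr
  rw [diagonal_eq_elemTensor]
  exact add_mem_dMax (smul_mem_dMax (elemTensor_mem_dMax (one_mem_posCone n)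
    (one_mem_posCone m)) hr.le) hA

/-! ### Closedness of the separable cone, and separation from it. -/

section Closed

attribute [local instance] Matrix.normedAddCommGroup Matrix.normedSpace

/-- The compact set of tensors of rank-one projections. -/
def productStates (n m : ℕ) : Set (Matrix (Fin n) (Fin n) (Mat m)) :=
  (fun p : EuclideanSpace ℂ (Fin n) × EuclideanSpace ℂ (Fin m) =>
      elemTensor (Matrix.vecMulVec p.1.ofLp (star p.1.ofLp))
        (Matrix.vecMulVec p.2.ofLp (star p.2.ofLp))) ''
    (Metric.sphere 0 1 ×ˢ Metric.sphere 0 1)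

theorem isCompact_productStates (n m : ℕ) : IsCompact (productStates n m) := by
  refine ((isCompact_sphere _ _).prod (isCompact_sphere _ _)).image ?_
  refine continuous_pi fun i => continuous_pi fun j => continuous_pi fun p => continuous_pi fun q => ?_
  simp only [elemTensor_apply, Matrix.vecMulVec_apply, Pi.star_apply]
  fun_prop

/-- The real part of the trace on `M_n(M_m)`. -/
noncomputable def reTrace (n m : ℕ) : Matrix (Fin n) (Fin n) (Mat m) →ₗ[ℝ] ℝ :=
  Complex.reLm ∘ₗ (Matrix.traceLinearMap (Fin m) ℝ ℂ) ∘ₗ (Matrix.traceLinearMap (Fin n) ℝ (Mat m))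

theorem trace_vecMulVec_of_mem_sphere {n : ℕ} {x : EuclideanSpace ℂ (Fin n)}
    (hx : x ∈ Metric.sphere 0 1) : (Matrix.vecMulVec x.ofLp (star x.ofLp)).trace = 1 := by
  have h : inner ℂ x x = 1 := by simp [inner_self_eq_norm_sq_to_K, mem_sphere_zero_iff_norm.1 hx]
  rw [PiLp.inner_apply] at h
  simpa [Matrix.trace, Matrix.vecMulVec_apply, Complex.mul_conj'] using h

theorem reTrace_of_mem_productStates {n m : ℕ} {A : Matrix (Fin n) (Fin n) (Mat m)}
    (hA : A ∈ productStates n m) : reTrace n m A = 1 := by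
  obtain ⟨⟨x, y⟩, ⟨hx, hy⟩, rfl⟩ := hA
  have h : ∀ (a : Mat n) (v : Mat m), (elemTensor a v).trace.trace = a.trace * v.trace := by
    intro a v
    simp [Matrix.trace, Matrix.sum_apply, elemTensor, Finset.sum_mul_sum]
    exact Finset.sum_comm
  simp [reTrace, h, trace_vecMulVec_of_mem_sphere hx, trace_vecMulVec_of_mem_sphere hy]

/-- Zero is a separate case because the unit sphere is empty in dimension 0. -/
theorem exists_smul_mem_sphere {n : ℕ} (x : Fin n → ℂ) : x = 0 ∨
    ∃ t : ℝ, 0 ≤ t ∧ ∃ y ∈ Metric.sphere (0 : EuclideanSpace ℂ (Fin n)) 1,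
      Matrix.vecMulVec x (star x) = (t : ℂ) • Matrix.vecMulVec y.ofLp (star y.ofLp) := by
  by_cases hx : WithLp.toLp 2 x = 0
  · left
    simpa using hx
  right
  have hn : ‖WithLp.toLp 2 x‖ ≠ 0 := norm_ne_zero_iff.2 hx
  refine ⟨‖WithLp.toLp 2 x‖ ^ 2, by positivity,
    ((‖WithLp.toLp 2 x‖⁻¹ : ℝ) : ℂ) • WithLp.toLp 2 x, ?_, ?_⟩
  · rw [mem_sphere_zero_iff_norm, norm_smul, Complex.norm_real, norm_inv, norm_norm,
      inv_mul_cancel₀ hn]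
  · have hc : ((‖WithLp.toLp 2 x‖ : ℝ) : ℂ) ≠ 0 := Complex.ofReal_ne_zero.2 hn
    ext i j
    simp [Matrix.vecMulVec_apply]
    field_simp

theorem ofReal_smul_matrix {n m : ℕ} (r : ℝ) (A : Matrix (Fin n) (Fin n) (Mat m)) :
    (r : ℂ) • A = r • A := by
  ext i j p q
  simp

theorem convex_dMax (n m : ℕ) : Convex ℝ (dMax (posCone m) n) := by
  intro X hX Y hY r s hr hs _
  rw [← ofReal_smul_matrix, ← ofReal_smul_matrix]
  exact add_mem_dMax (smul_mem_dMax hX hr) (smul_mem_dMax hY hs)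

/-- Both factors of a positive tensor split into rank-one positive matrices, each a nonnegative
multiple of a projection. -/
theorem dMax_eq_coneOver (n m : ℕ) :
    dMax (posCone m) n = coneOver (convexHull ℝ (productStates n m)) := by
  apply Set.Subset.antisymm
  · rintro _ ⟨q, a, v, ha, hv, rfl⟩
    refine sum_mem_coneOver (convex_convexHull ℝ _) _ fun l _ => ?_
    obtain ⟨d, x, hx⟩ := Matrix.posSemidef_iff_eq_sum_vecMulVec.1 (ha l)
    obtain ⟨e, y, hy⟩ := Matrix.posSemidef_iff_eq_sum_vecMulVec.1 (hv l)
    have hsum : elemTensor (a l) (v l) = ∑ i, ∑ j, elemTensor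
        (Matrix.vecMulVec (x i) (star (x i))) (Matrix.vecMulVec (y j) (star (y j))) := by
      ext i j p q
      simp [elemTensor_apply, hx, hy, Matrix.sum_apply, Finset.sum_mul_sum]
    rw [hsum]
    refine sum_mem_coneOver (convex_convexHull ℝ _) _ fun i _ =>
      sum_mem_coneOver (convex_convexHull ℝ _) _ fun j _ => ?_
    rcases exists_smul_mem_sphere (x i) with h | ⟨t, ht, x', hx', h⟩
    · left
      ext
      simp [elemTensor_apply, h]
    rcases exists_smul_mem_sphere (y j) with h' | ⟨u, hu, y', hy', h'⟩
    · left
      ext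
      simp [elemTensor_apply, h']
    convert smul_mem_coneOver (mul_nonneg ht hu) (subset_convexHull ℝ (productStates n m)
      (Set.mem_image_of_mem _ (Set.mk_mem_prod hx' hy'))) using 1
    rw [h, h']
    ext i j p q
    simp [elemTensor_apply]
    ring
  · rintro A (rfl | ⟨t, ht, B, hB, rfl⟩)
    · exact zero_mem_dMax _ _
    rw [← ofReal_smul_matrix]
    refine smul_mem_dMax (convexHull_min ?_ ?_ hB) ht
    · rintro _ ⟨⟨x, y⟩, _, rfl⟩
      exact elemTensor_mem_dMax (Matrix.posSemidef_vecMulVec_self_star _)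
        (Matrix.posSemidef_vecMulVec_self_star _)
    · exact convex_dMax n m

/-- The cone of separable elements of `M_n ⊗ M_m` is closed. -/
theorem isClosed_dMax (n m : ℕ) : IsClosed (dMax (posCone m) n) := by
  rw [dMax_eq_coneOver]
  refine isClosed_coneOver (isCompact_productStates n m).isCompact_convexHull
    (reTrace n m).toContinuousLinearMap fun x hx => ?_
  have hconv : Convex ℝ {A | reTrace n m A = 1} :=
    (convex_singleton (1 : ℝ)).linear_preimage (reTrace n m)
  exact convexHull_min (fun A hA => reTrace_of_mem_productStates hA) hconv hx

/-- Let `r → 0` in `rI + A` and use that the separable cone is closed. -/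
theorem omaxCone_eq_dMax (n m : ℕ) : omaxCone m n = dMax (posCone m) n := by
  refine Set.Subset.antisymm (fun A hA => ?_) (dMax_subset_omaxCone n m)
  have hlim : Filter.Tendsto
      (fun r : ℝ => (r : ℂ) • Matrix.diagonal (fun _ : Fin n => (1 : Mat m)) + A)
      (nhdsWithin 0 (Set.Ioi 0)) (nhds A) := by
    have hc : Continuous
        (fun r : ℝ => (r : ℂ) • Matrix.diagonal (fun _ : Fin n => (1 : Mat m)) + A) := by
      fun_prop
    simpa using (hc.tendsto 0).mono_left nhdsWithin_le_nhds
  exact (isClosed_dMax n m).mem_of_tendsto hlim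
    (Filter.eventually_of_mem self_mem_nhdsWithin fun r hr => hA r hr)

/-- A complex functional separating a non-separable element from the separable ones. -/
theorem exists_functional_of_notMem_dMax {n m : ℕ} {A : Matrix (Fin n) (Fin n) (Mat m)}
    (hA : A ∉ dMax (posCone m) n) : ∃ F : Matrix (Fin n) (Fin n) (Mat m) →ₗ[ℂ] ℂ,
      (∀ B ∈ dMax (posCone m) n, 0 ≤ (F B).re) ∧ (F A).re < 0 := by
  have : LocallyConvexSpace ℝ (Matrix (Fin n) (Fin n) (Mat m)) :=
    NormedSpace.toLocallyConvexSpace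
  obtain ⟨F, u, hu, hF⟩ :=
    RCLike.geometric_hahn_banach_point_closed (𝕜 := ℂ) (convex_dMax n m) (isClosed_dMax n m) hA
  have hu0 : u < 0 := by simpa using hF 0 (zero_mem_dMax _ _)
  refine ⟨F.toLinearMap, fun B hB => ?_, hu.trans hu0⟩
  by_contra! hneg
  -- This multiple of `B` stays in the cone but has real part exactly `u`, against the strict bound.
  have h := hF _ (smul_mem_dMax hB (r := u / (F B).re) (div_nonneg_of_nonpos hu0.le hneg.le))
  have hne : (F B).re ≠ 0 := hneg.ne
  simp [hne] at h

end Closed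

/-! ### Measure-and-prepare maps, the bilinear pairing and the transpose. -/

/-- `φ` is a finite sum of maps `X ↦ s(X) P` with `s` a positive functional and `P` positive. -/
def IsMeasureAndPrepare {k m : ℕ} (φ : Mat k →ₗ[ℂ] Mat m) : Prop :=
  ∃ (K : ℕ) (s : Fin K → Mat k →ₗ[ℂ] ℂ) (P : Fin K → Mat m),
    (∀ l, IsPositiveFunctional (posCone k) (s l)) ∧
    (∀ l, (P l).PosSemidef) ∧ ∀ X, φ X = ∑ l, s l X • P l

theorem gamma_apply {n : ℕ} (a Y : Mat n) : gamma n a Y = ∑ i, ∑ j, a i j * Y i j := by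
  have hrepr : ∀ (b : Mat n) (i j : Fin n),
      (Matrix.stdBasis ℂ (Fin n) (Fin n)).repr b (i, j) = b i j := fun b i j => by
    have hb : b = ∑ p, ∑ q, b p q • Matrix.stdBasis ℂ (Fin n) (Fin n) (p, q) := by
      conv_lhs => rw [Matrix.matrix_eq_sum_single b]
      simp [Matrix.stdBasis_eq_single]
    conv_lhs => rw [hb]
    simp [Finsupp.single_apply, ite_and]
  simp [gamma, Module.Basis.toDual, Module.Basis.constr_apply_fintype, Fintype.sum_prod_type, hrepr]

theorem gamma_comm {n : ℕ} (a Y : Mat n) : gamma n a Y = gamma n Y a := by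
  simp only [gamma_apply, mul_comm]

theorem sum_star_mul_mul_eq_gamma {n : ℕ} (a : Mat n) (x : Fin n → ℂ) :
    ∑ i, ∑ j, star (x i) * x j * a i j = gamma n a (Matrix.vecMulVec (star x) x) := by
  simp only [gamma_apply, Matrix.vecMulVec_apply, Pi.star_apply]
  exact Finset.sum_congr rfl fun i _ => Finset.sum_congr rfl fun j _ => by ring

/-- One direction tests on rank-one matrices; the other is the Schur product theorem, as the pairing
sums the entries of the Hadamard product. -/
theorem isPositiveFunctional_gamma_iff {n : ℕ} (a : Mat n) :
    IsPositiveFunctional (posCone n) (gamma n a) ↔ a.PosSemidef := by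
  refine ⟨fun h => posSemidef_iff_forall_sum_nonneg.2 fun x => ?_, fun h Y hY => ?_⟩
  · rw [sum_star_mul_mul_eq_gamma]
    exact h _ (Matrix.posSemidef_vecMulVec_star_self x)
  · have hs := posSemidef_iff_forall_sum_nonneg.1 (h.hadamard hY) 1
    simpa [gamma_apply] using hs

theorem gamma_flat {k m : ℕ} (φ : Mat k →ₗ[ℂ] Mat m) (Y : Mat m) (X : Mat k) :
    gamma k (flat φ Y) X = gamma m Y (φ X) := by
  simp [flat]

theorem flat_flat {k m : ℕ} (φ : Mat k →ₗ[ℂ] Mat m) : flat (flat φ) = φ := by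
  refine LinearMap.ext fun X => (gamma m).injective (LinearMap.ext fun Y => ?_)
  rw [gamma_flat, gamma_comm, gamma_flat, gamma_comm]

/-- Transposition exchanges the roles of functionals and matrices, and `gamma` respects positivity.
-/
theorem IsMeasureAndPrepare.flat {k m : ℕ} {φ : Mat k →ₗ[ℂ] Mat m} (h : IsMeasureAndPrepare φ) :
    IsMeasureAndPrepare (flat φ) := by
  obtain ⟨K, s, P, hs, hP, hφ⟩ := h
  refine ⟨K, fun l => gamma m (P l), fun l => (gamma k).symm (s l),
    fun l => (isPositiveFunctional_gamma_iff _).2 (hP l), fun l => ?_, fun Y => ?_⟩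
  · rw [← isPositiveFunctional_gamma_iff, LinearEquiv.apply_symm_apply]
    exact hs l
  · refine (gamma k).injective (LinearMap.ext fun X => ?_)
    rw [gamma_flat, hφ]
    simp [gamma_comm Y, mul_comm]

/-! ### Complete positivity and entanglement breaking. -/

theorem mapMatrix_eq_sum_elemTensor {k m K n : ℕ} {φ : Mat k →ₗ[ℂ] Mat m}
    {s : Fin K → Mat k →ₗ[ℂ] ℂ} {P : Fin K → Mat m} (hφ : ∀ X, φ X = ∑ l, s l X • P l)
    (A : Matrix (Fin n) (Fin n) (Mat k)) :
    φ.mapMatrix A = ∑ l, elemTensor ((s l).mapMatrix A) (P l) := by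
  ext i j p q
  simp [hφ, Matrix.sum_apply, elemTensor]

theorem IsMeasureAndPrepare.isCompletelyPositive_omin_omax {k m : ℕ} {φ : Mat k →ₗ[ℂ] Mat m}
    (h : IsMeasureAndPrepare φ) : IsCompletelyPositive (ominCone k) (omaxCone m) φ := by
  obtain ⟨K, s, P, hs, hP, hφ⟩ := h
  intro n A hA
  rw [omaxCone_eq_dMax, mapMatrix_eq_sum_elemTensor hφ]
  exact mem_dMax_of_fintype (fun l => mapMatrix_mem_posCone (hs l) hA) hP

theorem IsPositiveFunctional.tensor {n m : ℕ} {s : Mat n →ₗ[ℂ] ℂ} {t : Mat m →ₗ[ℂ] ℂ}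
    (hs : IsPositiveFunctional (posCone n) s) (ht : IsPositiveFunctional (posCone m) t) :
    IsPositiveFunctional (ominCone m n) (tensorFunctional s t) :=
  fun _ hA => hs _ (mapMatrix_mem_posCone ht hA)

theorem isPositiveFunctional_sum {V : Type*} [AddCommGroup V] [Module ℂ V] {P : Set V}
    {ι : Type*} [Fintype ι] {f : ι → V →ₗ[ℂ] ℂ} (hf : ∀ l, IsPositiveFunctional P (f l)) :
    IsPositiveFunctional P (∑ l, f l) := fun v hv => by
  rw [LinearMap.sum_apply]
  exact Finset.sum_nonneg fun l _ => hf l v hv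

/-- The composite `f ∘ φ_n` is the sum of the products `f(· ⊗ P_l) ⊗ s_l`. -/
theorem IsMeasureAndPrepare.isEntanglementBreaking {k m : ℕ} {φ : Mat k →ₗ[ℂ] Mat m}
    (h : IsMeasureAndPrepare φ) : IsEntanglementBreaking φ := by
  obtain ⟨K, s, P, hs, hP, hφ⟩ := h
  intro n f hf
  let tensorRight (l : Fin K) : Mat n →ₗ[ℂ] Matrix (Fin n) (Fin n) (Mat m) :=
    (LinearMap.toSpanSingleton ℂ (Mat m) (P l)).mapMatrix
  have hr : ∀ l, IsPositiveFunctional (posCone n) (f ∘ₗ tensorRight l) := fun l a ha =>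
    hf.1 _ (elemTensor_mem_stdCone ha (hP l))
  have heq : f ∘ₗ φ.mapMatrix = ∑ l, tensorFunctional (f ∘ₗ tensorRight l) (s l) := by
    refine LinearMap.ext fun A => ?_
    rw [LinearMap.comp_apply, mapMatrix_eq_sum_elemTensor hφ, map_sum, LinearMap.sum_apply]
    rfl
  refine ⟨?_, K, _, s, hr, hs, heq⟩
  rw [heq]
  exact fun A hA => isPositiveFunctional_sum (fun l => (hr l).tensor (hs l)) A
    (stdCone_subset_ominCone n k hA)

/-- The functional `A ↦ ⟨x, A x⟩` on `M_n(M_m)`. -/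
noncomputable def vectorFunctional {n m : ℕ} (x : Fin n → Fin m → ℂ) :
    Matrix (Fin n) (Fin n) (Mat m) →ₗ[ℂ] ℂ where
  toFun A := ∑ i, ∑ p, ∑ j, ∑ q, star (x i p) * x j q * A i j p q
  map_add' A B := by simp [mul_add, Finset.sum_add_distrib]
  map_smul' c A := by
    simp only [Matrix.smul_apply, smul_eq_mul, RingHom.id_apply, Finset.mul_sum]
    simp only [mul_left_comm]

/-- Vector functionals detect positivity. Normalized to a state and composed with `φ_n`, each
becomes separable, hence nonnegative on the whole OMIN cone. -/
theorem IsEntanglementBreaking.isCompletelyPositive_omin {k m : ℕ} {φ : Mat k →ₗ[ℂ] Mat m}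
    (h : IsEntanglementBreaking φ) : IsCompletelyPositive (ominCone k) (stdCone m) φ := by
  intro n A hA
  rw [mem_stdCone_iff]
  intro x
  change 0 ≤ vectorFunctional x (φ.mapMatrix A)
  have hpos : IsPositiveFunctional (stdCone m n) (vectorFunctional x) :=
    fun B hB => mem_stdCone_iff.1 hB x
  have hone : vectorFunctional x 1 = ((∑ i, ∑ p, ‖x i p‖ ^ 2 : ℝ) : ℂ) := by
    have h1 : ∀ i j p q, (1 : Matrix (Fin n) (Fin n) (Mat m)) i j p q =
        if i = j then (if p = q then 1 else 0) else 0 := by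
      intro i j p q
      by_cases hij : i = j <;> simp [Matrix.one_apply, hij]
    simp [vectorFunctional, h1, Complex.conj_mul']
  set r : ℝ := ∑ i, ∑ p, ‖x i p‖ ^ 2
  have hr0 : 0 ≤ r := by positivity
  -- The zero vector cannot be normalized to a state.
  rcases hr0.eq_or_lt with h0 | h0
  · have hx : ∀ i p, x i p = 0 := by
      intro i p
      have h1 := (Finset.sum_eq_zero_iff_of_nonneg (fun i _ => by positivity)).1 h0.symm i
        (Finset.mem_univ i)
      have h2 := (Finset.sum_eq_zero_iff_of_nonneg (fun i _ => by positivity)).1 h1 p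
        (Finset.mem_univ p)
      simpa using h2
    simp [vectorFunctional, hx]
  have hrc : (r : ℂ) ≠ 0 := Complex.ofReal_ne_zero.2 h0.ne'
  have hrinv : (0 : ℂ) ≤ ((r⁻¹ : ℝ) : ℂ) := Complex.zero_le_real.2 (by positivity)
  obtain ⟨-, q, s, t, hs, ht, heq⟩ := h n (((r⁻¹ : ℝ) : ℂ) • vectorFunctional x)
    ⟨fun B hB => mul_nonneg hrinv (hpos B hB), by simp [hone, hrc]⟩
  have hval := isPositiveFunctional_sum (fun l => (hs l).tensor (ht l)) A hA
  rw [← heq] at hval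
  have := mul_nonneg (Complex.zero_le_real.2 hr0) hval
  simpa [hrc] using this

/-! ### Choi matrices. -/

/-- The Choi matrix `(φ(E_ij))_ij`. -/
def choi {k m : ℕ} (φ : Mat k →ₗ[ℂ] Mat m) : Matrix (Fin k) (Fin k) (Mat m) :=
  Matrix.of fun i j => φ (Matrix.single i j 1)

theorem apply_eq_sum_choi {k m : ℕ} (φ : Mat k →ₗ[ℂ] Mat m) (X : Mat k) :
    φ X = ∑ i, ∑ j, X i j • choi φ i j := by
  conv_lhs => rw [Matrix.matrix_eq_sum_single X]
  simp only [map_sum, choi, Matrix.of_apply, ← map_smul, Matrix.smul_single, smul_eq_mul, mul_one]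

/-- A decomposition `∑ a_l ⊗ P_l` of the Choi matrix reads `φ(X) = ∑ γ(a_l)(X) P_l`. -/
theorem isMeasureAndPrepare_of_choi_mem {k m : ℕ} {φ : Mat k →ₗ[ℂ] Mat m}
    (h : choi φ ∈ dMax (posCone m) k) : IsMeasureAndPrepare φ := by
  obtain ⟨K, a, P, ha, hP, heq⟩ := h
  refine ⟨K, fun l => gamma k (a l), P, fun l => (isPositiveFunctional_gamma_iff _).2 (ha l), hP,
    fun X => ?_⟩
  rw [apply_eq_sum_choi, heq]
  ext p q
  simp only [Matrix.sum_apply, Matrix.smul_apply, smul_eq_mul, elemTensor_apply, gamma_apply,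
    Finset.mul_sum, Finset.sum_mul]
  refine (Finset.sum_congr rfl fun i _ => Finset.sum_comm).trans ?_
  rw [Finset.sum_comm]
  exact Finset.sum_congr rfl fun l _ => Finset.sum_congr rfl fun i _ =>
    Finset.sum_congr rfl fun j _ => by ring

/-- This is `v v*` for the unnormalized maximally entangled vector `v = ∑ e_i ⊗ e_i`. -/
theorem single_mem_stdCone (k : ℕ) :
    (Matrix.of fun i j => Matrix.single i j 1 : Matrix (Fin k) (Fin k) (Mat k)) ∈ stdCone k k := by
  have h := Matrix.posSemidef_vecMulVec_self_star
    (fun ip : Fin k × Fin k => if ip.1 = ip.2 then (1 : ℂ) else 0)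
  change (Matrix.comp _ _ _ _ ℂ _).PosSemidef
  convert h using 1
  ext ⟨i, p⟩ ⟨j, q⟩
  simp only [Matrix.comp_apply, Matrix.of_apply, Matrix.single_apply, Matrix.vecMulVec_apply,
    Pi.star_apply]
  split_ifs <;> simp_all

theorem isMeasureAndPrepare_of_isCompletelyPositive_omax {k m : ℕ} {φ : Mat k →ₗ[ℂ] Mat m}
    (h : IsCompletelyPositive (stdCone k) (omaxCone m) φ) : IsMeasureAndPrepare φ := by
  refine isMeasureAndPrepare_of_choi_mem ?_
  rw [← omaxCone_eq_dMax]
  exact h k _ (single_mem_stdCone k)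

/-! ### Block-positive witnesses against separability. -/

theorem eq_sum_elemTensor_single {n m : ℕ} (Z : Matrix (Fin n) (Fin n) (Mat m)) :
    Z = ∑ i, ∑ j, ∑ p, ∑ q, Z i j p q •
      elemTensor (Matrix.single i j (1 : ℂ)) (Matrix.single p q (1 : ℂ)) := by
  ext i j p q
  simp [Matrix.sum_apply, elemTensor_apply, Matrix.single_apply, ite_and]

/-- The element of `M_m(M_n)` whose pairing with a Hermitian `Z` in `M_n(M_m)` is `2 Re F(Z)`. -/
noncomputable def witness {n m : ℕ} (F : Matrix (Fin n) (Fin n) (Mat m) →ₗ[ℂ] ℂ) :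
    Matrix (Fin m) (Fin m) (Mat n) :=
  Matrix.of fun p q => Matrix.of fun i j =>
    F (elemTensor (Matrix.single i j 1) (Matrix.single p q 1)) +
      star (F (elemTensor (Matrix.single j i 1) (Matrix.single q p 1)))

theorem sum_mul_witness {n m : ℕ} (F : Matrix (Fin n) (Fin n) (Mat m) →ₗ[ℂ] ℂ)
    {Z : Matrix (Fin n) (Fin n) (Mat m)} (hZ : ∀ i j p q, star (Z i j p q) = Z j i q p) :
    ∑ i, ∑ j, ∑ p, ∑ q, Z i j p q * witness F p q i j = ((2 * (F Z).re : ℝ) : ℂ) := by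
  have hF : F Z = ∑ i, ∑ j, ∑ p, ∑ q, Z i j p q *
      F (elemTensor (Matrix.single i j 1) (Matrix.single p q 1)) := by
    conv_lhs => rw [eq_sum_elemTensor_single Z]
    simp only [map_sum, map_smul, smul_eq_mul]
  have hF' : star (F Z) = ∑ i, ∑ j, ∑ p, ∑ q, Z i j p q *
      star (F (elemTensor (Matrix.single j i 1) (Matrix.single q p 1))) := by
    rw [hF]
    simp only [star_sum, star_mul', hZ]
    rw [Finset.sum_comm]
    exact Finset.sum_congr rfl fun i _ => Finset.sum_congr rfl fun j _ => Finset.sum_comm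
  have h2 : ((2 * (F Z).re : ℝ) : ℂ) = F Z + star (F Z) := by
    rw [Complex.star_def, Complex.add_conj]
  rw [h2, hF']
  nth_rewrite 1 [hF]
  simp only [witness, Matrix.of_apply, mul_add, Finset.sum_add_distrib]

/-- On a product vector the form of the witness is `2 Re F` at a tensor of rank-one positive
matrices, with the factors swapped. -/
theorem witness_mem_ominCone {n m : ℕ} {F : Matrix (Fin n) (Fin n) (Mat m) →ₗ[ℂ] ℂ}
    (hF : ∀ B ∈ dMax (posCone m) n, 0 ≤ (F B).re) : witness F ∈ ominCone n m := by
  rw [mem_ominCone_iff]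
  intro c x
  have hmem := hF (elemTensor (Matrix.vecMulVec (star x) x) (Matrix.vecMulVec (star c) c))
    (elemTensor_mem_dMax (Matrix.posSemidef_vecMulVec_star_self x)
      (Matrix.posSemidef_vecMulVec_star_self c))
  have hsum := sum_mul_witness F
    (Z := elemTensor (Matrix.vecMulVec (star x) x) (Matrix.vecMulVec (star c) c))
    (fun i j p q => by simp [elemTensor_apply, Matrix.vecMulVec_apply]; ring)
  have h0 : (0 : ℂ) ≤ ((2 * (F (elemTensor (Matrix.vecMulVec (star x) x)
      (Matrix.vecMulVec (star c) c))).re : ℝ) : ℂ) := Complex.zero_le_real.2 (by positivity)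
  rw [← hsum] at h0
  simpa [elemTensor_apply, Matrix.vecMulVec_apply, Finset.mul_sum, mul_assoc] using h0

theorem isMeasureAndPrepare_of_isCompletelyPositive_omin {k m : ℕ} {φ : Mat k →ₗ[ℂ] Mat m}
    (h : IsCompletelyPositive (ominCone k) (stdCone m) φ) : IsMeasureAndPrepare φ := by
  refine isMeasureAndPrepare_of_choi_mem ?_
  by_contra hnot
  obtain ⟨F, hF, hneg⟩ := exists_functional_of_notMem_dMax hnot
  have hchoi : choi φ ∈ stdCone m k :=
    h k _ (stdCone_subset_ominCone k k (single_mem_stdCone k))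
  -- The witness computes `2 Re F` only on Hermitian arguments.
  have hherm : ∀ i j p q, star (choi φ i j p q) = choi φ j i q p := fun i j p q =>
    (Matrix.PosSemidef.isHermitian hchoi).apply (j, q) (i, p)
  -- Testing on `∑ e_p ⊗ e_p` turns the image of the witness into its pairing with the Choi matrix.
  have hpos := mem_stdCone_iff.1 (h m _ (witness_mem_ominCone hF))
    fun p q => if p = q then 1 else 0
  have hval : ∑ p, ∑ q, φ (witness F p q) p q = ((2 * (F (choi φ)).re : ℝ) : ℂ) := by
    rw [← sum_mul_witness F hherm]
    simp only [apply_eq_sum_choi φ (witness F _ _), Matrix.sum_apply, Matrix.smul_apply,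
      smul_eq_mul]
    refine (Finset.sum_congr rfl fun p _ => Finset.sum_comm).trans ?_
    rw [Finset.sum_comm]
    refine Finset.sum_congr rfl fun i _ => ?_
    refine (Finset.sum_congr rfl fun p _ => Finset.sum_comm).trans ?_
    rw [Finset.sum_comm]
    exact Finset.sum_congr rfl fun j _ => Finset.sum_congr rfl fun p _ =>
      Finset.sum_congr rfl fun q _ => mul_comm _ _
  have hpos' : 0 ≤ ∑ p, ∑ q, φ (witness F p q) p q := by simpa using hpos
  rw [hval, Complex.zero_le_real] at hpos'
  linarith

/-! ### Kraus decompositions of rank one. -/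

theorem conjTranspose_vecMulVec_mul_mul {k m : ℕ} (u : Fin k → ℂ) (w : Fin m → ℂ) (X : Mat k) :
    (Matrix.vecMulVec u w).conjTranspose * X * Matrix.vecMulVec u w =
      gamma k (Matrix.vecMulVec (star u) u) X • Matrix.vecMulVec (star w) w := by
  ext p q
  simp only [Matrix.mul_apply, Matrix.conjTranspose_apply, Matrix.vecMulVec_apply, gamma_apply,
    Matrix.smul_apply, smul_eq_mul, Pi.star_apply, Finset.sum_mul, star_mul']
  rw [Finset.sum_comm]
  exact Finset.sum_congr rfl fun i _ => Finset.sum_congr rfl fun j _ => by ring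

/-- Every column is a multiple of one vector spanning the range. -/
theorem exists_eq_vecMulVec_of_rank_eq_one {k m : ℕ} {A : Matrix (Fin k) (Fin m) ℂ}
    (hA : A.rank = 1) : ∃ (u : Fin k → ℂ) (w : Fin m → ℂ), A = Matrix.vecMulVec u w := by
  obtain ⟨v, -, hv⟩ := finrank_eq_one_iff'.1 hA
  choose c hc using fun q => hv ⟨A.mulVec (Pi.single q 1), Pi.single q 1, rfl⟩
  refine ⟨v, c, ?_⟩
  ext i q
  have := congrFun (congrArg Subtype.val (hc q)) i
  simp only [Matrix.mulVec_single_one, Matrix.col_apply] at this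
  rw [← this, Matrix.vecMulVec_apply, mul_comm]
  rfl

theorem rank_eq_one_of_vecMulVec_ne_zero {k m : ℕ} {u : Fin k → ℂ} {w : Fin m → ℂ}
    (h : Matrix.vecMulVec u w ≠ 0) : (Matrix.vecMulVec u w).rank = 1 := by
  refine le_antisymm (Matrix.rank_vecMulVec_le u w) (Nat.one_le_iff_ne_zero.2 fun h0 => h ?_)
  rw [Matrix.rank, Submodule.finrank_eq_zero, LinearMap.range_eq_bot] at h0
  refine Matrix.ext_of_mulVec_single fun j => ?_
  rw [← Matrix.mulVecLin_apply, h0, LinearMap.zero_apply, Matrix.zero_mulVec]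

theorem posSemidef_iff_exists_sum_vecMulVec_star {n : ℕ} {a : Mat n} : a.PosSemidef ↔
    ∃ (d : ℕ) (v : Fin d → Fin n → ℂ), a = ∑ i, Matrix.vecMulVec (star (v i)) (v i) := by
  rw [Matrix.posSemidef_iff_eq_sum_vecMulVec]
  constructor <;> rintro ⟨d, v, rfl⟩ <;> exact ⟨d, fun i => star (v i), by simp⟩

/-- Measure-and-prepare maps are exactly those with a Kraus decomposition into rank-one matrices. -/
theorem isMeasureAndPrepare_iff_exists_rank_one {k m : ℕ} (φ : Mat k →ₗ[ℂ] Mat m) :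
    IsMeasureAndPrepare φ ↔ ∃ (N : ℕ) (A : Fin N → Matrix (Fin k) (Fin m) ℂ),
      (∀ l, (A l).rank = 1) ∧ ∀ X, φ X = ∑ l, (A l).conjTranspose * X * A l := by
  classical
  constructor
  · rintro ⟨K, s, P, hs, hP, hφ⟩
    have ha : ∀ l, ((gamma k).symm (s l)).PosSemidef := fun l => by
      rw [← isPositiveFunctional_gamma_iff, LinearEquiv.apply_symm_apply]
      exact hs l
    choose d u hu using fun l => posSemidef_iff_exists_sum_vecMulVec_star.1 (ha l)
    choose e w hw using fun l => posSemidef_iff_exists_sum_vecMulVec_star.1 (hP l)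
    let A : (Σ l, Fin (d l) × Fin (e l)) → Matrix (Fin k) (Fin m) ℂ :=
      fun t => Matrix.vecMulVec (u t.1 t.2.1) (w t.1 t.2.2)
    have hsum : ∀ X, φ X = ∑ t, (A t).conjTranspose * X * A t := fun X => by
      rw [hφ, Fintype.sum_sigma]
      refine Finset.sum_congr rfl fun l _ => ?_
      have hsl : s l X = ∑ i, gamma k (Matrix.vecMulVec (star (u l i)) (u l i)) X := by
        rw [← LinearMap.sum_apply, ← map_sum, ← hu l, LinearEquiv.apply_symm_apply]
      simp only [A, conjTranspose_vecMulVec_mul_mul, Fintype.sum_prod_type]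
      rw [hsl, hw l, Finset.sum_smul_sum]
    -- Vanishing products have rank zero and must be dropped; they contribute nothing to the sum.
    let e := Fintype.equivFin {t // A t ≠ 0}
    refine ⟨_, fun l => A (e.symm l), fun l => rank_eq_one_of_vecMulVec_ne_zero (e.symm l).2,
      fun X => ?_⟩
    rw [e.symm.sum_comp fun t : {t // A t ≠ 0} => (A t).conjTranspose * X * A t, hsum]
    refine (Fintype.sum_of_injective Subtype.val Subtype.val_injective _ _ (fun t ht => ?_)
      fun _ => rfl).symm
    have ht0 : A t = 0 := by simpa using ht
    simp [ht0]
  · rintro ⟨N, A, hA, hφ⟩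
    choose u w huw using fun l => exists_eq_vecMulVec_of_rank_eq_one (hA l)
    refine ⟨N, fun l => gamma k (Matrix.vecMulVec (star (u l)) (u l)),
      fun l => Matrix.vecMulVec (star (w l)) (w l), fun l => ?_, fun l => ?_, fun X => ?_⟩
    · exact (isPositiveFunctional_gamma_iff _).2 (Matrix.posSemidef_vecMulVec_star_self _)
    · exact Matrix.posSemidef_vecMulVec_star_self _
    · simp only [hφ, huw, conjTranspose_vecMulVec_mul_mul]

end OpSys

/-! ### The equivalence. -/

theorem theorem5 (k m : ℕ) (φ : OpSys.Mat k →ₗ[ℂ] OpSys.Mat m) :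
    [ OpSys.IsCompletelyPositive (OpSys.ominCone k) (OpSys.stdCone m) φ,
      OpSys.IsEntanglementBreaking φ,
      OpSys.IsCoEntanglementBreaking φ,
      OpSys.IsCompletelyPositive (OpSys.stdCone k) (OpSys.omaxCone m) φ,
      ∃ (K : ℕ) (s : Fin K → OpSys.Mat k →ₗ[ℂ] ℂ) (P : Fin K → OpSys.Mat m),
        (∀ l, OpSys.IsPositiveFunctional (OpSys.posCone k) (s l)) ∧
        (∀ l, (P l).PosSemidef) ∧
        ∀ X, φ X = ∑ l, s l X • P l,
      ∃ (N : ℕ) (A : Fin N → Matrix (Fin k) (Fin m) ℂ),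
        (∀ l, (A l).rank = 1) ∧
        ∀ X, φ X = ∑ l, (A l).conjTranspose * X * A l,
      OpSys.IsCompletelyPositive (OpSys.ominCone k) (OpSys.omaxCone m) φ ].TFAE := by
  tfae_have 5 → 7 := fun h =>
    OpSys.IsMeasureAndPrepare.isCompletelyPositive_omin_omax h
  tfae_have 7 → 1 := fun h n A hA =>
    OpSys.dMax_subset_stdCone n m (OpSys.omaxCone_eq_dMax n m ▸ h n A hA)
  tfae_have 7 → 4 := fun h n A hA => h n A (OpSys.stdCone_subset_ominCone n k hA)
  tfae_have 4 → 5 := OpSys.isMeasureAndPrepare_of_isCompletelyPositive_omax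
  tfae_have 1 → 5 := OpSys.isMeasureAndPrepare_of_isCompletelyPositive_omin
  tfae_have 5 → 2 := fun h => OpSys.IsMeasureAndPrepare.isEntanglementBreaking h
  tfae_have 2 → 1 := OpSys.IsEntanglementBreaking.isCompletelyPositive_omin
  tfae_have 5 → 3 := fun h =>
    (OpSys.IsMeasureAndPrepare.flat h).isEntanglementBreaking
  -- The implications (ii) ⇒ (i) ⇒ (v) are applied to `flat φ`, and transposing again returns to
  -- `φ`.
  tfae_have 3 → 5 := fun h => by
    have hflat := (OpSys.isMeasureAndPrepare_of_isCompletelyPositive_omin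
      (OpSys.IsEntanglementBreaking.isCompletelyPositive_omin h)).flat
    rwa [OpSys.flat_flat] at hflat
  tfae_have 5 ↔ 6 := OpSys.isMeasureAndPrepare_iff_exists_rank_one φ
  tfae_finish
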